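/- Let $p$ be a prime and let $h_1,h_2\ge 1$ be relatively prime integers. Let $L=(L_1,L_2)$ be the unique pair of power series in $\mathbb{Q}_p[[x_1,x_2]]$ such that $$L_1(x_1,x_2)=x_1+p^{-1}L_2(x_1^{p^{h_1}},x_2^{p^{h_1}}),\qquad L_2(x_1,x_2)=x_2+p^{-1}L_1(x_1^{p^{h_2}},x_2^{p^{h_2}}),$$ and, writing $X=(x_1,x_2)$ and $Y=(y_1,y_2)$, let $F(X,Y)=L^{-1}(L(X)+L(Y))$ be the two-dimensional Lubin–Tate formal group over $\mathbb{Z}_p$ attached to $(h_1,h_2)$, where $L^{-1}$ is the inverse of $L$ for composition of power series. Define $[0]_F(X)=0$, $[1]_F(X)=X$ and $[k]_F(X)=F(X,[k-1]_F(X))$ for $k\ge 2$. Fix an algebraic closure $\overline{\mathbb{Q}}_p$ of $\mathbb{Q}_p$ with the extended $p$-adic absolute value, and for $n\ge 1$ let $F[p^n]$ be the set of all $\alpha\in\overline{\mathbb{Q}}_p^{\,2}$ such that both components of the power series $[p^n]_F$ converge at $\alpha$ with sum $0$. Then, for every $n\ge 1$, the field $\mathbb{Q}_p(F[p^n])\subset\overline{\mathbb{Q}}_p$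 generated over $\mathbb{Q}_p$ by the coordinates of the points of $F[p^n]$ is a Galois extension of $\mathbb{Q}_p$. -/

import Mathlib

noncomputable section

namespace LubinTateDimTwo

open MvPowerSeries

section Composition

variable {K : Type*} [CommRing K]

/-- Successive approximations of the compositional inverse of a pair `L = (L₁, L₂)` of power series
in two variables with `L(X) ≡ X` modulo terms of degree two: `M₀ = 0` and
`Mₖ₊₁ = X - (L(Mₖ) - Mₖ)`. -/
def inverseApprox (L : Fin 2 → MvPowerSeries (Fin 2) K) : ℕ → Fin 2 → MvPowerSeries (Fin 2) K
  | 0 => 0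
  | k + 1 => fun i => X i - (subst (inverseApprox L k) (L i) - inverseApprox L k i)

/-- The compositional inverse `L⁻¹` of a pair of power series with `L(X) ≡ X` modulo terms of degree
two: the limit of the successive approximations, the `k`-th of which is correct in degrees `< k`.
The lemmas `subst_compInverse` and `subst_self_compInverse` below say `L(L⁻¹(X)) = X` and
`L⁻¹(L(X)) = X`. -/
def compInverse (L : Fin 2 → MvPowerSeries (Fin 2) K) : Fin 2 → MvPowerSeries (Fin 2) K :=
  fun i m => coeff m (inverseApprox L (m.degree + 1) i)

theorem inverseApprox_succ (L : Fin 2 → MvPowerSeries (Fin 2) K) (k : ℕ) (i : Fin 2) :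
    inverseApprox L (k + 1) i =
      X i - (subst (inverseApprox L k) (L i) - inverseApprox L k i) := rfl

theorem coeff_compInverse (L : Fin 2 → MvPowerSeries (Fin 2) K) (i : Fin 2) (m : Fin 2 →₀ ℕ) :
    coeff m (compInverse L i) = coeff m (inverseApprox L (m.degree + 1) i) :=
  coeff_apply _ _

theorem order_prod_sub {a b : Fin 2 → MvPowerSeries (Fin 2) K}
    (ha : ∀ i, constantCoeff (a i) = 0) (hb : ∀ i, constantCoeff (b i) = 0) {n : ℕ}
    (hab : ∀ i, (n : ℕ∞) ≤ (a i - b i).order) (e : Fin 2 →₀ ℕ) :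
    ((n + e.degree : ℕ) : ℕ∞) ≤
      (e.prod (fun s k => a s ^ k) - e.prod (fun s k => b s ^ k)).order + 1 ∧
    ((e.degree : ℕ) : ℕ∞) ≤ (e.prod (fun s k => a s ^ k)).order := by
  induction h : e.degree generalizing e with
  | zero =>
    have : e = 0 := (Finsupp.degree_eq_zero_iff e).1 h
    subst this
    simp
  | succ d ih =>
    obtain ⟨j, hj⟩ : ∃ j, e j ≠ 0 := by
      by_contra! hc
      have : e = 0 := Finsupp.ext hc
      simp [this] at h
    obtain ⟨e', rfl⟩ : ∃ e', e = Finsupp.single j 1 + e' :=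
      ⟨e - Finsupp.single j 1, by
        ext i
        by_cases hi : j = i
        · subst hi; simp; omega
        · simp [hi]⟩
    have hd : e'.degree = d := by
      have : (Finsupp.single j 1 + e').degree = 1 + e'.degree := by simp
      omega
    obtain ⟨h1, h2⟩ := ih e' hd
    have split : ∀ c : Fin 2 → MvPowerSeries (Fin 2) K,
        (Finsupp.single j 1 + e').prod (fun s k => c s ^ k) =
          c j * e'.prod (fun s k => c s ^ k) := by
      intro c
      rw [Finsupp.prod_add_index' (by simp) (by intros; rw [pow_add])]
      simp
    have ha1 : 1 ≤ (a j).order := one_le_order_iff_constCoeff_eq_zero.2 (ha j)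
    have hb1 : 1 ≤ (b j).order := one_le_order_iff_constCoeff_eq_zero.2 (hb j)
    rw [split a, split b]
    refine ⟨?_, ?_⟩
    · have : a j * e'.prod (fun s k => a s ^ k) - b j * e'.prod (fun s k => b s ^ k) =
          (a j - b j) * e'.prod (fun s k => a s ^ k) +
          b j * (e'.prod (fun s k => a s ^ k) - e'.prod (fun s k => b s ^ k)) := by ring
      rw [this]
      have h3 : ((n + d : ℕ) : ℕ∞) ≤ ((a j - b j) * e'.prod (fun s k => a s ^ k)).order := by
        push_cast
        exact (add_le_add (hab j) h2).trans le_order_mul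
      have h4 : ((n + d : ℕ) : ℕ∞) ≤
          (b j * (e'.prod (fun s k => a s ^ k) - e'.prod (fun s k => b s ^ k))).order := by
        refine h1.trans ?_
        rw [add_comm]
        exact (add_le_add hb1 le_rfl).trans le_order_mul
      have := (le_min h3 h4).trans min_order_le_add
      calc ((n + (d + 1) : ℕ) : ℕ∞) = ((n + d : ℕ) : ℕ∞) + 1 := by push_cast; ring
        _ ≤ _ := add_le_add this le_rfl
    · push_cast
      rw [add_comm]
      exact (add_le_add ha1 h2).trans le_order_mul

theorem coeff_subst_congr {a b : Fin 2 → MvPowerSeries (Fin 2) K}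
    (ha : ∀ i, constantCoeff (a i) = 0) (hb : ∀ i, constantCoeff (b i) = 0) {n : ℕ}
    (hab : ∀ i, (n : ℕ∞) ≤ (a i - b i).order) {G : MvPowerSeries (Fin 2) K}
    (hG : 2 ≤ G.order) : ((n + 1 : ℕ) : ℕ∞) ≤ (subst a G - subst b G).order := by
  refine nat_le_order fun d hd => ?_
  rw [map_sub, coeff_subst (hasSubst_of_constantCoeff_zero ha),
    coeff_subst (hasSubst_of_constantCoeff_zero hb), sub_eq_zero]
  refine finsum_congr fun e => ?_
  by_cases he : e.degree < 2
  · rw [coeff_of_lt_order (lt_of_lt_of_le (by exact_mod_cast he) hG)]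
    simp
  · congr 1
    rw [← sub_eq_zero, ← map_sub]
    apply coeff_of_lt_order
    have h1 := (order_prod_sub ha hb hab e).1
    have h2 : ((n + 1 : ℕ) : ℕ∞) + 1 ≤
        (e.prod (fun s k => a s ^ k) - e.prod (fun s k => b s ^ k)).order + 1 := by
      refine le_trans ?_ h1
      exact_mod_cast (by omega)
    have h3 := (ENat.add_le_add_iff_right ENat.one_ne_top).1 h2
    exact lt_of_lt_of_le (by exact_mod_cast hd) h3

variable {L : Fin 2 → MvPowerSeries (Fin 2) K}

theorem constantCoeff_of_order (hL : ∀ i, 2 ≤ (L i - X i).order) (i : Fin 2) :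
    constantCoeff (L i) = 0 := by
  have : constantCoeff (L i - X i) = 0 :=
    one_le_order_iff_constCoeff_eq_zero.1 (le_trans (by norm_num) (hL i))
  simpa using this

theorem subst_sub_X {a : Fin 2 → MvPowerSeries (Fin 2) K}
    (ha : ∀ i, constantCoeff (a i) = 0) (i : Fin 2) :
    subst a (L i - X i) = subst a (L i) - a i := by
  rw [subst_sub (hasSubst_of_constantCoeff_zero ha),
    subst_X (hasSubst_of_constantCoeff_zero ha)]

theorem constantCoeff_inverseApprox (hL : ∀ i, 2 ≤ (L i - X i).order) (k : ℕ) (i : Fin 2) :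
    constantCoeff (inverseApprox L k i) = 0 := by
  induction k generalizing i with
  | zero => simp [inverseApprox]
  | succ k ih =>
    simp [inverseApprox, ih, constantCoeff_subst_eq_zero (hasSubst_of_constantCoeff_zero ih) ih
      (constantCoeff_of_order hL i)]

theorem order_inverseApprox_succ_sub (hL : ∀ i, 2 ≤ (L i - X i).order) (k : ℕ) (i : Fin 2) :
    (k : ℕ∞) ≤ (inverseApprox L (k + 1) i - inverseApprox L k i).order := by
  induction k generalizing i with
  | zero => simp
  | succ k ih =>
    have h := coeff_subst_congr (constantCoeff_inverseApprox hL (k + 1))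
      (constantCoeff_inverseApprox hL k) ih (hL i)
    rw [subst_sub_X (constantCoeff_inverseApprox hL (k + 1)),
      subst_sub_X (constantCoeff_inverseApprox hL k)] at h
    rw [← order_neg] at h
    refine h.trans_eq (congrArg order ?_)
    rw [inverseApprox_succ L (k + 1), inverseApprox_succ L k]
    ring

theorem order_inverseApprox_sub (hL : ∀ i, 2 ≤ (L i - X i).order) (k l : ℕ) (i : Fin 2) :
    (k : ℕ∞) ≤ (inverseApprox L (k + l) i - inverseApprox L k i).order := by
  induction l with
  | zero => simp
  | succ l ih =>
    have h := order_inverseApprox_succ_sub hL (k + l) i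
    have h' : (k : ℕ∞) ≤ (inverseApprox L (k + l + 1) i - inverseApprox L (k + l) i).order :=
      le_trans (by exact_mod_cast Nat.le_add_right k l) h
    have := (le_min h' ih).trans min_order_le_add
    simpa [add_assoc] using this

theorem order_compInverse_sub (hL : ∀ i, 2 ≤ (L i - X i).order) (k : ℕ) (i : Fin 2) :
    (k : ℕ∞) ≤ (compInverse L i - inverseApprox L k i).order := by
  refine nat_le_order fun d hd => ?_
  have h : coeff d (compInverse L i) = coeff d (inverseApprox L (d.degree + 1) i) :=
    coeff_compInverse L i d
  obtain ⟨l, rfl⟩ := Nat.exists_eq_add_of_le (Nat.succ_le_of_lt hd)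
  have := coeff_of_lt_order (lt_of_lt_of_le
    (by exact_mod_cast Nat.lt_succ_self d.degree)
    (order_inverseApprox_sub hL (d.degree + 1) l i))
  rw [map_sub, h, ← neg_sub, ← map_sub, this, neg_zero]

theorem constantCoeff_compInverse (hL : ∀ i, 2 ≤ (L i - X i).order) (i : Fin 2) :
    constantCoeff (compInverse L i) = 0 := by
  have h := one_le_order_iff_constCoeff_eq_zero.1
    (by exact_mod_cast order_compInverse_sub hL 1 i :
      1 ≤ (compInverse L i - inverseApprox L 1 i).order)
  rw [map_sub, constantCoeff_inverseApprox hL] at h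
  simpa using h

/-- `L(L⁻¹(X)) = X`. -/
theorem subst_compInverse (hL : ∀ i, 2 ≤ (L i - X i).order) (i : Fin 2) :
    subst (compInverse L) (L i) = X i := by
  rw [← sub_eq_zero, ← order_eq_top_iff]
  refine ENat.eq_top_iff_forall_ge.2 fun k => ?_
  have h1 := coeff_subst_congr (constantCoeff_compInverse hL)
    (constantCoeff_inverseApprox hL k) (order_compInverse_sub hL k) (hL i)
  rw [subst_sub_X (constantCoeff_compInverse hL),
    subst_sub_X (constantCoeff_inverseApprox hL k)] at h1
  have h2 := order_compInverse_sub hL (k + 1) i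
  have h3 := (le_min h1 h2).trans min_order_le_add
  refine le_trans (by exact_mod_cast Nat.le_succ k) (h3.trans_eq ?_)
  congr 1
  rw [inverseApprox_succ]
  ring

theorem order_compInverse_sub_X (hL : ∀ i, 2 ≤ (L i - X i).order) (i : Fin 2) :
    2 ≤ (compInverse L i - X i).order := by
  have h1 := coeff_subst_congr (n := 1) (constantCoeff_compInverse hL)
    (b := 0) (by simp) (fun i => by
      simpa using one_le_order_iff_constCoeff_eq_zero.2 (constantCoeff_compInverse hL i)) (hL i)
  have h0 : constantCoeff (L i - X i) = 0 := by
    simp [constantCoeff_of_order hL i]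
  rw [subst_zero_of_constantCoeff_zero h0, sub_zero, subst_sub_X (constantCoeff_compInverse hL),
    subst_compInverse hL, ← order_neg, neg_sub] at h1
  exact_mod_cast h1

/-- `L⁻¹(L(X)) = X`. -/
theorem subst_self_compInverse (hL : ∀ i, 2 ≤ (L i - X i).order) (i : Fin 2) :
    subst L (compInverse L i) = X i := by
  have hM := order_compInverse_sub_X hL
  have key : compInverse (compInverse L) = L := by
    funext j
    have h := subst_comp_subst_apply
      (hasSubst_of_constantCoeff_zero (constantCoeff_compInverse hL))
      (hasSubst_of_constantCoeff_zero (constantCoeff_compInverse hM)) (L j)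
    rw [subst_compInverse hL,
      subst_X (hasSubst_of_constantCoeff_zero (constantCoeff_compInverse hM))] at h
    rw [h]
    simp_rw [subst_compInverse hM]
    change subst X (L j) = L j
    rw [subst_self]; rfl
  have := subst_compInverse hM i
  rwa [key] at this

end Composition

section Logarithm

variable {K : Type*} [CommRing K]

/-- The power series `∑_{k ≥ 0} c k * x_j ^ (e k)` in the two variables `x₀`, `x₁`, for exponents
`e 0 < e 1 < ⋯`. As `k ≤ e k`, only indices `k ≤ m j` can contribute to the monomial `m`. -/
def lacunary (j : Fin 2) (c : ℕ → K) (e : ℕ → ℕ) : MvPowerSeries (Fin 2) K :=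
  fun m => ∑ k ∈ Finset.range (m j + 1), if m = Finsupp.single j (e k) then c k else 0

theorem coeff_lacunary (j : Fin 2) (c : ℕ → K) {e : ℕ → ℕ} (he : ∀ k, k ≤ e k) (m : Fin 2 →₀ ℕ)
    {N : ℕ} (hN : m j < N) :
    coeff m (lacunary j c e) =
      ∑ k ∈ Finset.range N, if m = Finsupp.single j (e k) then c k else 0 := by
  change ∑ k ∈ Finset.range (m j + 1), _ = _
  refine Finset.sum_subset (Finset.range_mono hN) fun k _ hk => if_neg ?_
  rintro rfl
  simp only [Finsupp.single_eq_same, Finset.mem_range, not_lt] at hk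
  have := he k
  omega

theorem expand_lacunary (j : Fin 2) (c : ℕ → K) {e : ℕ → ℕ} (he : ∀ k, k ≤ e k) {q : ℕ}
    (hq : q ≠ 0) : expand q hq (lacunary j c e) = lacunary j c (fun k => q * e k) := by
  have he' : ∀ k, k ≤ q * e k := fun k =>
    (he k).trans (Nat.le_mul_of_pos_left _ (Nat.pos_of_ne_zero hq))
  ext m
  by_cases hm : ∃ m', m = q • m'
  · obtain ⟨m', rfl⟩ := hm
    have h1 : m' j < (q • m') j + 1 := by
      have := Nat.le_mul_of_pos_left (m' j) (Nat.pos_of_ne_zero hq)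
      simp only [Finsupp.smul_apply, smul_eq_mul]
      omega
    rw [coeff_expand_smul, coeff_lacunary j c he m' h1,
      coeff_lacunary j c he' (q • m') (Nat.lt_succ_self _)]
    refine Finset.sum_congr rfl fun k _ => ?_
    have : (q • m' = Finsupp.single j (q * e k)) ↔ m' = Finsupp.single j (e k) := by
      rw [← smul_eq_mul, ← Finsupp.smul_single]
      exact nsmul_right_inj hq
    simp only [this]
  · have h1 : coeff m (expand q hq (lacunary j c e)) = 0 := by
      by_contra hne
      obtain ⟨i, hi⟩ : ∃ i, ¬ q ∣ m i := by
        by_contra! hc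
        choose m' hm' using hc
        exact hm ⟨Finsupp.equivFunOnFinite.symm m', by ext i; simp [hm' i]⟩
      exact hne (coeff_expand_of_not_dvd q hq _ hi)
    rw [h1, coeff_lacunary j c he' m (Nat.lt_succ_self _)]
    refine (Finset.sum_eq_zero fun k _ => if_neg fun h => hm ⟨Finsupp.single j (e k), ?_⟩).symm
    rw [h, Finsupp.smul_single, smul_eq_mul]

theorem lacunary_succ (j : Fin 2) (c : ℕ → K) {e : ℕ → ℕ} (he : ∀ k, k < e k) :
    lacunary j c e = monomial (Finsupp.single j (e 0)) (c 0) +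
      lacunary j (fun k => c (k + 1)) (fun k => e (k + 1)) := by
  ext m
  rw [map_add, coeff_lacunary j c (fun k => (he k).le) m (N := m j + 1 + 1) (by omega),
    coeff_lacunary j _ (fun k => (Nat.le_succ k).trans (he (k + 1)).le) m (N := m j + 1) (by omega),
    Finset.sum_range_succ', coeff_monomial, add_comm]

theorem smul_lacunary (j : Fin 2) (r : K) (c : ℕ → K) (e : ℕ → ℕ) :
    r • lacunary j c e = lacunary j (fun k => r * c k) e := by
  ext m
  rw [coeff_smul]
  change r * (∑ k ∈ Finset.range (m j + 1), _) = ∑ k ∈ Finset.range (m j + 1), _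
  rw [Finset.mul_sum]
  exact Finset.sum_congr rfl fun k _ => by rw [mul_ite, mul_zero]

end Logarithm

variable (p : ℕ) [Fact p.Prime] (h₁ h₂ : ℕ)

/-- The logarithm `L = (L₁, L₂)` attached to `(h₁, h₂)`:
`L₁ = ∑_{k ≥ 0} p^(-2k) x₁^(p^(k(h₁+h₂))) + ∑_{k ≥ 0} p^(-(2k+1)) x₂^(p^(h₁+k(h₁+h₂)))`,
`L₂ = ∑_{k ≥ 0} p^(-2k) x₂^(p^(k(h₁+h₂))) + ∑_{k ≥ 0} p^(-(2k+1)) x₁^(p^(h₂+k(h₁+h₂)))`.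
The lemma `logarithm_functionalEquation` below is the functional equation which defines it, and
`logarithm_unique` says that this equation has no other solution. -/
def logarithm : Fin 2 → MvPowerSeries (Fin 2) ℚ_[p] :=
  ![lacunary 0 (fun k => ((p : ℚ_[p]) ^ (2 * k))⁻¹) (fun k => p ^ (k * (h₁ + h₂))) +
      lacunary 1 (fun k => ((p : ℚ_[p]) ^ (2 * k + 1))⁻¹) (fun k => p ^ (h₁ + k * (h₁ + h₂))),
    lacunary 1 (fun k => ((p : ℚ_[p]) ^ (2 * k))⁻¹) (fun k => p ^ (k * (h₁ + h₂))) +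
      lacunary 0 (fun k => ((p : ℚ_[p]) ^ (2 * k + 1))⁻¹) (fun k => p ^ (h₂ + k * (h₁ + h₂)))]

theorem lt_prime_pow_mul {h : ℕ} (hh : 0 < h) (k : ℕ) : k < p ^ (k * h) :=
  (Nat.lt_pow_self (Fact.out : p.Prime).one_lt).trans_le
    (Nat.pow_le_pow_right (Fact.out : p.Prime).pos (Nat.le_mul_of_pos_right k hh))

theorem lt_prime_pow_add_mul (a : ℕ) {h : ℕ} (hh : 0 < h) (k : ℕ) : k < p ^ (a + k * h) :=
  (lt_prime_pow_mul p hh k).trans_le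
    (Nat.pow_le_pow_right (Fact.out : p.Prime).pos (Nat.le_add_left _ _))

theorem prime_pow_ne_zero (a : ℕ) : p ^ a ≠ 0 := pow_ne_zero a (Fact.out : p.Prime).ne_zero

theorem lacunary_sum_functionalEquation (i j : Fin 2) (a : ℕ) {b : ℕ} (hab : 0 < a + b) :
    lacunary i (fun k => ((p : ℚ_[p]) ^ (2 * k))⁻¹) (fun k => p ^ (k * (a + b))) +
      lacunary j (fun k => ((p : ℚ_[p]) ^ (2 * k + 1))⁻¹) (fun k => p ^ (a + k * (a + b))) =
    X i + (p : ℚ_[p])⁻¹ • expand (p ^ a) (prime_pow_ne_zero p a)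
      (lacunary j (fun k => ((p : ℚ_[p]) ^ (2 * k))⁻¹) (fun k => p ^ (k * (a + b))) +
        lacunary i (fun k => ((p : ℚ_[p]) ^ (2 * k + 1))⁻¹) (fun k => p ^ (b + k * (a + b)))) := by
  rw [lacunary_succ i _ (lt_prime_pow_mul p hab), map_add,
    expand_lacunary j _ (fun k => (lt_prime_pow_mul p hab k).le),
    expand_lacunary i _ (fun k => (lt_prime_pow_add_mul p b hab k).le), smul_add,
    smul_lacunary, smul_lacunary, add_assoc, add_comm (lacunary j _ _)]
  congr 1
  · simp [X]
  · congr 2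
    · funext k
      rw [← mul_inv, ← pow_succ', show 2 * (k + 1) = 2 * k + 1 + 1 by ring]
    · funext k
      rw [← pow_add]
      congr 1
      ring
    · funext k
      rw [← mul_inv, ← pow_succ']
    · funext k
      rw [← pow_add]

/-- The functional equation of the logarithm:
`L₁(x₁, x₂) = x₁ + p⁻¹ L₂(x₁^(p^h₁), x₂^(p^h₁))` and
`L₂(x₁, x₂) = x₂ + p⁻¹ L₁(x₁^(p^h₂), x₂^(p^h₂))`. -/
theorem logarithm_functionalEquation (hh : 0 < h₁ + h₂) :
    logarithm p h₁ h₂ 0 = X 0 + (p : ℚ_[p])⁻¹ • expand (p ^ h₁) (prime_pow_ne_zero p h₁)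
      (logarithm p h₁ h₂ 1) ∧
    logarithm p h₁ h₂ 1 = X 1 + (p : ℚ_[p])⁻¹ • expand (p ^ h₂) (prime_pow_ne_zero p h₂)
      (logarithm p h₁ h₂ 0) := by
  constructor
  · exact lacunary_sum_functionalEquation p 0 1 h₁ hh
  · have := lacunary_sum_functionalEquation p 1 0 h₂ (b := h₁) (by omega)
    rw [add_comm h₂ h₁] at this
    exact this

theorem expand_eq_self_of_coeff {f g : MvPowerSeries (Fin 2) ℚ_[p]} {q : ℕ} (hq : q ≠ 0)
    (hq1 : 1 < q) {m : Fin 2 →₀ ℕ} (hm : m ≠ 0)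
    (h : ∀ d : Fin 2 →₀ ℕ, d.degree < m.degree → coeff d f = coeff d g) :
    coeff m (expand q hq f) = coeff m (expand q hq g) := by
  by_cases hm' : ∀ i, q ∣ m i
  · choose c hc using hm'
    obtain ⟨d, rfl⟩ : ∃ d : Fin 2 →₀ ℕ, m = q • d :=
      ⟨Finsupp.equivFunOnFinite.symm c, by ext i; simp [hc i]⟩
    rw [coeff_expand_smul, coeff_expand_smul]
    refine h d ?_
    have hd : d.degree ≠ 0 := fun h0 => hm (by
      rw [(Finsupp.degree_eq_zero_iff d).1 h0, smul_zero])
    have : (q • d).degree = q * d.degree := by simp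
    rw [this]
    exact lt_mul_left (Nat.pos_of_ne_zero hd) hq1
  · push Not at hm'
    obtain ⟨i, hi⟩ := hm'
    rw [coeff_expand_of_not_dvd q hq _ hi, coeff_expand_of_not_dvd q hq _ hi]

/-- The functional equation determines the logarithm. -/
theorem logarithm_unique (hh₁ : 0 < h₁) (hh₂ : 0 < h₂) {A B : MvPowerSeries (Fin 2) ℚ_[p]}
    (hA : A = X 0 + (p : ℚ_[p])⁻¹ • expand (p ^ h₁) (prime_pow_ne_zero p h₁) B)
    (hB : B = X 1 + (p : ℚ_[p])⁻¹ • expand (p ^ h₂) (prime_pow_ne_zero p h₂) A) :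
    ![A, B] = logarithm p h₁ h₂ := by
  obtain ⟨hA', hB'⟩ := logarithm_functionalEquation p h₁ h₂ (by omega)
  generalize logarithm p h₁ h₂ = L at hA' hB'
  have hp1 : 1 < p := (Fact.out : p.Prime).one_lt
  have zero : ∀ A B : MvPowerSeries (Fin 2) ℚ_[p],
      A = X 0 + (p : ℚ_[p])⁻¹ • expand (p ^ h₁) (prime_pow_ne_zero p h₁) B →
      B = X 1 + (p : ℚ_[p])⁻¹ • expand (p ^ h₂) (prime_pow_ne_zero p h₂) A →
      constantCoeff A = 0 ∧ constantCoeff B = 0 := by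
    intro A B hA hB
    have h1 : constantCoeff A = (p : ℚ_[p])⁻¹ * constantCoeff B := by
      conv_lhs => rw [hA]
      simp
    have h2 : constantCoeff B = (p : ℚ_[p])⁻¹ * constantCoeff A := by
      conv_lhs => rw [hB]
      simp
    have hp0 : (p : ℚ_[p]) ≠ 0 := by exact_mod_cast (Fact.out : p.Prime).ne_zero
    have h3 : ((p : ℚ_[p]) ^ 2 - 1) * constantCoeff A = 0 := by
      have h4 : (p : ℚ_[p]) ^ 2 * constantCoeff A = constantCoeff A := by
        conv_lhs => rw [h1, h2]
        field_simp
      rw [sub_mul, h4, one_mul, sub_self]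
    have h5 : ((p : ℚ_[p]) ^ 2 - 1) ≠ 0 := by
      rw [sub_ne_zero]
      exact_mod_cast (one_lt_pow₀ hp1 two_ne_zero).ne'
    have h6 := (mul_eq_zero.1 h3).resolve_left h5
    exact ⟨h6, by rw [h2, h6, mul_zero]⟩
  have main : ∀ (N : ℕ) (m : Fin 2 →₀ ℕ), m.degree = N →
      coeff m A = coeff m (L 0) ∧ coeff m B = coeff m (L 1) := by
    intro N
    induction N using Nat.strong_induction_on with
    | _ N ih =>
      intro m hmN
      by_cases hm : m = 0
      · subst hm
        obtain ⟨h1, h2⟩ := zero A B hA hB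
        obtain ⟨h3, h4⟩ := zero _ _ hA' hB'
        simp only [coeff_zero_eq_constantCoeff]
        exact ⟨h1.trans h3.symm, h2.trans h4.symm⟩
      · have e1 := expand_eq_self_of_coeff p (prime_pow_ne_zero p h₁)
          (one_lt_pow₀ hp1 hh₁.ne') hm (f := B) (g := L 1)
          (fun d hd => (ih d.degree (hmN ▸ hd) d rfl).2)
        have e2 := expand_eq_self_of_coeff p (prime_pow_ne_zero p h₂)
          (one_lt_pow₀ hp1 hh₂.ne') hm (f := A) (g := L 0)
          (fun d hd => (ih d.degree (hmN ▸ hd) d rfl).1)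
        constructor
        · rw [hA, hA', map_add, map_add, coeff_smul, coeff_smul, e1]
        · rw [hB, hB', map_add, map_add, coeff_smul, coeff_smul, e2]
  funext i
  fin_cases i
  · ext m
    exact (main _ m rfl).1
  · ext m
    exact (main _ m rfl).2

/-- `L(X) ≡ X` modulo terms of degree two, so that `L` has a compositional inverse. -/
theorem order_logarithm_sub_X (hh₁ : 0 < h₁) (hh₂ : 0 < h₂) (i : Fin 2) :
    2 ≤ (logarithm p h₁ h₂ i - X i).order := by
  have hp1 : 1 < p := (Fact.out : p.Prime).one_lt
  obtain ⟨h0, h1⟩ := logarithm_functionalEquation p h₁ h₂ (by omega)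
  have key : ∀ (a : ℕ), 0 < a → ∀ f : MvPowerSeries (Fin 2) ℚ_[p], constantCoeff f = 0 →
      2 ≤ ((p : ℚ_[p])⁻¹ • expand (p ^ a) (prime_pow_ne_zero p a) f).order := by
    intro a ha f hf
    refine nat_le_order (n := 2) fun d hd => ?_
    rw [coeff_smul]
    by_cases hd0 : d = 0
    · subst hd0
      simp [hf]
    · rw [expand_eq_self_of_coeff p _ (one_lt_pow₀ hp1 ha.ne') hd0 (g := 0)]
      · simp
      · intro d' hd'
        have : d' = 0 := (Finsupp.degree_eq_zero_iff d').1 (by omega)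
        subst this
        simpa using hf
  have hc : ∀ i, constantCoeff (logarithm p h₁ h₂ i) = 0 := by
    have hl : ∀ (j : Fin 2) (c : ℕ → ℚ_[p]) (e : ℕ → ℕ), (∀ k, k < e k) →
        constantCoeff (lacunary j c e) = 0 := by
      intro j c e he
      rw [← coeff_zero_eq_constantCoeff_apply, coeff_lacunary j c (fun k => (he k).le) 0
        (N := 1) (by simp)]
      simp only [Finset.sum_range_one]
      refine if_neg fun h => (he 0).ne ?_
      simpa using DFunLike.congr_fun h j
    have hh : 0 < h₁ + h₂ := by omega
    intro i
    fin_cases i <;>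
    simp [logarithm, hl _ _ _ (lt_prime_pow_mul p hh), hl _ _ _ (lt_prime_pow_add_mul p _ hh)]
  fin_cases i
  · change 2 ≤ (logarithm p h₁ h₂ 0 - X 0).order
    rw [h0, add_sub_cancel_left]
    exact key _ hh₁ _ (hc 1)
  · change 2 ≤ (logarithm p h₁ h₂ 1 - X 1).order
    rw [h1, add_sub_cancel_left]
    exact key _ hh₂ _ (hc 0)

/-- The two-dimensional Lubin-Tate formal group `F(X, Y) = L⁻¹(L(X) + L(Y))`. The variables
indexed by `Sum.inl` are `X = (x₁, x₂)`, those indexed by `Sum.inr` are `Y = (y₁, y₂)`. -/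
def formalGroup : Fin 2 → MvPowerSeries (Fin 2 ⊕ Fin 2) ℚ_[p] := fun i =>
  subst (fun j => subst (fun s => (X (Sum.inl s) : MvPowerSeries (Fin 2 ⊕ Fin 2) ℚ_[p]))
        (logarithm p h₁ h₂ j) +
      subst (fun s => (X (Sum.inr s) : MvPowerSeries (Fin 2 ⊕ Fin 2) ℚ_[p]))
        (logarithm p h₁ h₂ j))
    (compInverse (logarithm p h₁ h₂) i)

/-- `L(F(X, Y)) = L(X) + L(Y)`. -/
theorem subst_formalGroup_logarithm (hh₁ : 0 < h₁) (hh₂ : 0 < h₂) (i : Fin 2) :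
  subst (formalGroup p h₁ h₂) (logarithm p h₁ h₂ i) =
    subst (fun s => (X (Sum.inl s) : MvPowerSeries (Fin 2 ⊕ Fin 2) ℚ_[p])) (logarithm p h₁ h₂ i) +
    subst (fun s => (X (Sum.inr s) : MvPowerSeries (Fin 2 ⊕ Fin 2) ℚ_[p])) (logarithm p h₁ h₂ i) := by
  have hL := order_logarithm_sub_X p h₁ h₂ hh₁ hh₂
  have hc := constantCoeff_of_order hL
  have h1 : HasSubst (fun s => (X (Sum.inl s) : MvPowerSeries (Fin 2 ⊕ Fin 2) ℚ_[p])) :=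
    hasSubst_of_constantCoeff_zero (by simp)
  have h2 : HasSubst (fun s => (X (Sum.inr s) : MvPowerSeries (Fin 2 ⊕ Fin 2) ℚ_[p])) :=
    hasSubst_of_constantCoeff_zero (by simp)
  have hz : HasSubst (fun j => subst (fun s => (X (Sum.inl s) : MvPowerSeries (Fin 2 ⊕ Fin 2) ℚ_[p]))
        (logarithm p h₁ h₂ j) +
      subst (fun s => (X (Sum.inr s) : MvPowerSeries (Fin 2 ⊕ Fin 2) ℚ_[p]))
        (logarithm p h₁ h₂ j)) := hasSubst_of_constantCoeff_zero (by
          intro j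
          rw [map_add, constantCoeff_subst_eq_zero h1 (by simp) (hc j),
            constantCoeff_subst_eq_zero h2 (by simp) (hc j), add_zero])
  have := subst_comp_subst_apply (hasSubst_of_constantCoeff_zero (constantCoeff_compInverse hL)) hz
    (logarithm p h₁ h₂ i)
  rw [subst_compInverse hL, subst_X hz] at this
  exact this.symm

/-- Multiplication by `k` in `F`: `[0](X) = 0`, `[1](X) = X`, and `[k](X) = F(X, [k-1](X))`. -/
def mulEndo : ℕ → Fin 2 → MvPowerSeries (Fin 2) ℚ_[p]
  | 0 => 0
  | 1 => X
  | k + 2 => fun i => subst (Sum.elim X (mulEndo (k + 1))) (formalGroup p h₁ h₂ i)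

/-- The power series `f` with coefficients in `ℚ_p` converges at the point `x` of `(ℚ̄_p)²`, for the
`p`-adic absolute value of `ℚ̄_p`, and its sum is zero. -/
def VanishesAt (f : MvPowerSeries (Fin 2) ℚ_[p]) (x : Fin 2 → PadicAlgCl p) : Prop :=
  HasSum (fun m : Fin 2 →₀ ℕ => algebraMap ℚ_[p] (PadicAlgCl p) (coeff m f) * ∏ j, x j ^ m j) 0

/-- The set `F[p^n]` of `p^n`-torsion points: the `x ∈ (ℚ̄_p)²` with `[p^n](x) = 0`. -/
def torsionPoints (n : ℕ) : Set (Fin 2 → PadicAlgCl p) :=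
  {x | ∀ i, VanishesAt p (mulEndo p h₁ h₂ (p ^ n) i) x}

/-- The subfield `ℚ_p(F[p^n])` of `ℚ̄_p` generated over `ℚ_p` by the coordinates of the points of
`F[p^n]`. -/
def torsionField (n : ℕ) : IntermediateField ℚ_[p] (PadicAlgCl p) :=
  IntermediateField.adjoin ℚ_[p] {a | ∃ x ∈ torsionPoints p h₁ h₂ n, ∃ i, x i = a}

end LubinTateDimTwo

end

namespace LubinTateDimTwo

/-! ### Galois automorphisms and the `p`-adic absolute value. -/

variable (p : ℕ) [Fact p.Prime]

/-! The set `F[p^n]` is cut out by power series with coefficients in `ℚ_p`, so it should be stable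
under every automorphism `σ` of `ℚ̄_p` over `ℚ_p`, exactly as the roots of a polynomial over `ℚ_p`
are. What has to be justified is that `σ` may be applied term by term to a convergent infinite sum.
It may, because `σ` is an isometry: the absolute value of `ℚ̄_p` is the spectral norm, which depends
only on the minimal polynomial over `ℚ_p`.

Hence `σ` permutes the generators of `ℚ_p(F[p^n])` among themselves and maps this field into itself
(`map_torsionField_le`). A subextension of the normal extension `ℚ̄_p / ℚ_p` that is stable under
all automorphisms is normal, and separability is automatic in characteristic zero. -/

/-- Automorphisms of `ℚ̄_p` over `ℚ_p` preserve the `p`-adic absolute value. -/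
theorem norm_algEquiv_apply (σ : PadicAlgCl p ≃ₐ[ℚ_[p]] PadicAlgCl p) (x : PadicAlgCl p) :
    ‖σ x‖ = ‖x‖ := by
  -- Both norms are spectral norms, and `x` and `σ x` have the same minimal polynomial over `ℚ_p`.
  rw [← PadicAlgCl.spectralNorm_eq, ← PadicAlgCl.spectralNorm_eq]
  exact (spectralNorm_eq_of_equiv σ x).symm

/-- An additive map that preserves the norm is an isometry. Continuity is what lets `σ` pass through
infinite sums. -/
theorem continuous_algEquiv (σ : PadicAlgCl p ≃ₐ[ℚ_[p]] PadicAlgCl p) : Continuous σ :=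
  (AddMonoidHomClass.isometry_of_norm σ (norm_algEquiv_apply p σ)).continuous

/-! ### Galois action on zeros of power series. -/

variable {p}

/-- The zeros in `ℚ̄_p` of a power series over `ℚ_p` are stable under `Gal(ℚ̄_p / ℚ_p)`. -/
theorem VanishesAt.map_algEquiv {f : MvPowerSeries (Fin 2) ℚ_[p]} {x : Fin 2 → PadicAlgCl p}
    (hx : VanishesAt p f x) (σ : PadicAlgCl p ≃ₐ[ℚ_[p]] PadicAlgCl p) :
    VanishesAt p f (fun j => σ (x j)) := by
  -- The sum `0` already lies in `ℚ̄_p`, so no completion is needed. Since `σ` fixes the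
  -- coefficients and is multiplicative, it turns each term at `x` into the corresponding term at `σ
  -- x`, while `σ 0 = 0`.
  have h := HasSum.map hx σ (continuous_algEquiv p σ)
  simpa [VanishesAt, Function.comp_def] using h

theorem map_mem_torsionPoints {h₁ h₂ n : ℕ} {x : Fin 2 → PadicAlgCl p}
    (hx : x ∈ torsionPoints p h₁ h₂ n) (σ : PadicAlgCl p ≃ₐ[ℚ_[p]] PadicAlgCl p) :
    (fun j => σ (x j)) ∈ torsionPoints p h₁ h₂ n :=
  fun i => (hx i).map_algEquiv σ

/-! ### Stability and normality of the torsion field. -/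

variable (p)

/-- The image of a generated field is generated by the images of the generators, so it is enough to
follow coordinates: `σ (x i)` is the `i`-th coordinate of the torsion point obtained by applying `σ`
to each coordinate of `x`. One inclusion for every `σ` is enough, since `σ⁻¹` supplies the other. -/
theorem map_torsionField_le (h₁ h₂ n : ℕ) (σ : PadicAlgCl p ≃ₐ[ℚ_[p]] PadicAlgCl p) :
    (torsionField p h₁ h₂ n).map (σ : PadicAlgCl p →ₐ[ℚ_[p]] PadicAlgCl p) ≤
      torsionField p h₁ h₂ n := by
  rw [torsionField, IntermediateField.adjoin_map]
  refine IntermediateField.adjoin.mono _ _ _ ?_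
  rintro _ ⟨_, ⟨x, hx, i, rfl⟩, rfl⟩
  exact ⟨_, map_mem_torsionPoints hx σ, i, rfl⟩

end LubinTateDimTwo

theorem theorem4p1 (p : ℕ) [Fact p.Prime] (h₁ h₂ : ℕ) (hh₁ : 0 < h₁) (hh₂ : 0 < h₂)
    (hcop : Nat.Coprime h₁ h₂) (n : ℕ) (hn : 1 ≤ n) :
    IsGalois ℚ_[p] (LubinTateDimTwo.torsionField p h₁ h₂ n) := by
  -- The stability criterion for subfields requires a normal ambient extension; an algebraic closure
  -- is one.
  have : Normal ℚ_[p] (PadicAlgCl p) := IsAlgClosure.normal _ _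
  have : Normal ℚ_[p] (LubinTateDimTwo.torsionField p h₁ h₂ n) :=
    IntermediateField.normal_iff_forall_map_le'.2
      (LubinTateDimTwo.map_torsionField_le p h₁ h₂ n)
  -- Both fields of `IsGalois` are found by instance search: normality from the line above,
  -- separability from characteristic zero.
  exact { }
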